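/- Let $\Omega\subset\mathbb R^2$ be a bounded domain, $X_0=L^2(\Omega)\times L^2(\Omega)$ and $X_1=H^1(\Omega)\times H^1(\Omega)$. Let $D=(D_{ij}):\mathbb R^2\to M_{2\times 2}(\mathbb R)$ satisfy, for some constants $\alpha,L,M>0$: - (H1) $\xi^T D(z)\xi\ge\alpha|\xi|^2$ for all $z,\xi\in\mathbb R^2$; - (H2) $|D_{ij}(z')-D_{ij}(z)|\le L|z'-z|$ for all $z,z'\in\mathbb R^2$ and $i,j=1,2$; - (H3) $|D_{ij}(z)|\le M$ for all $z\in\mathbb R^2$ and $i,j=1,2$. For ${\bf u}=(u,v)^T$ consider the cross-diffusion system $$\partial_t u=\operatorname{div}(D_{11}({\bf u})\nabla u+D_{12}({\bf u})\nabla v),\qquad \partial_t v=\operatorname{div}(D_{21}({\bf u})\nabla u+D_{22}({\bf u})\nabla v)$$ in $\Omega$ with the boundary conditions $\langle D_{i1}({\bf u})\nabla u+D_{i2}({\bf u})\nabla v,{\bf n}\rangle=0$ ($i=1,2$) on $\partial\Omega$. A weak solution on $[0,T]$ with initial data ${\bf u}_0\in X_0$ is a function ${\bf u}\in C([0,T];X_0)\cap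 L^2(0,T;X_1)$ with distributional time derivative $\partial_t{\bf u}\in L^2(0,T;(X_1)')$, with ${\bf u}(0)={\bf u}_0$, and such that for almost every $t\in(0,T]$ and all ${\bf w}\in X_1$ $$\langle\partial_t{\bf u}(t),{\bf w}\rangle+\int_\Omega\operatorname{tr}\big((J{\bf w})^TD({\bf u}(t))\,J{\bf u}(t)\big)\,d\Omega=0,$$ where $J$ denotes the Jacobian matrix. A weak solution on $[0,\infty)$ is a function on $[0,\infty)$ that is a weak solution on $[0,T]$ for every $T>0$. For $t\ge0$ let $T_t({\bf u}_0):={\bf u}(t)$, where ${\bf u}$ is the unique weak solution on $[0,\infty)$ with initial data ${\bf u}_0$; $T_t({\bf u}_0)$ is defined exactly when this solution exists and is unique. Assume in addition that $D(-z)=D(z)$ for all $z\in\mathbb R^2$. Then $$T_t(-{\bf u}_0)=-T_t({\bf u}_0)\qquad\text{for all } t\ge0 \text{ and all } {\bf u}_0\in X_0 \text{ (in particular for all } {\bf u}_0\in X_1),$$ in the sense that one side is defined if and only if the other is, and then they are equal. Moreover, irrespective of uniqueness, for every $T>0$ and every ${\bf u}_0\in X_0$, a function ${\bf u}$ is a weak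 solution on $[0,T]$ with initial data ${\bf u}_0$ if and only if $-{\bf u}$ is a weak solution on $[0,T]$ with initial data $-{\bf u}_0$. -/

import Mathlib

open MeasureTheory Set
open scoped ContDiff

noncomputable section

namespace CrossDiffusion

/-- The Euclidean plane; it is both the space of positions `x` and the space of values `(u, v)`. -/
abbrev Plane : Type := EuclideanSpace ℝ (Fin 2)

/-- The Lebesgue space `L²(Ω)` of real functions. -/
abbrev L2 (Ω : Set Plane) : Type := Lp ℝ 2 (volume.restrict Ω)

/-- The Lebesgue space `L²(Ω; ℝ²)` of vector fields. -/
abbrev L2Vec (Ω : Set Plane) : Type := Lp Plane 2 (volume.restrict Ω)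

/-- `G` is the weak gradient of `f` on `Ω`:
`∫_Ω f ∂ₖφ = - ∫_Ω Gₖ φ` for all `φ ∈ C_c^∞(Ω)` and `k = 1, 2`. -/
def HasWeakGradient (Ω : Set Plane) (f : L2 Ω) (G : L2Vec Ω) : Prop :=
  ∀ φ : Plane → ℝ, ContDiff ℝ ∞ φ → HasCompactSupport φ → tsupport φ ⊆ Ω → ∀ k : Fin 2,
    ∫ x in Ω, f x * fderiv ℝ φ x (EuclideanSpace.single k 1) = - ∫ x in Ω, G x k * φ x

theorem integrable_mul_test {Ω : Set Plane} {f ψ : Plane → ℝ}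
    (hf : MemLp f 2 (volume.restrict Ω)) (hψ : Continuous ψ) (hc : HasCompactSupport ψ) :
    Integrable (fun x => f x * ψ x) (volume.restrict Ω) :=
  hf.integrable_mul (q := 2) ((hψ.memLp_of_hasCompactSupport (p := 2) hc).restrict Ω)

theorem integrable_mul_fderiv {Ω : Set Plane} (f : L2 Ω) {φ : Plane → ℝ}
    (hφ : ContDiff ℝ ∞ φ) (hc : HasCompactSupport φ) (v : Plane) :
    Integrable (fun x => f x * fderiv ℝ φ x v) (volume.restrict Ω) :=
  integrable_mul_test (Lp.memLp f)
    ((hφ.continuous_fderiv (by simp)).clm_apply continuous_const) (hc.fderiv_apply ℝ v)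

theorem integrable_coord_mul {Ω : Set Plane} (G : L2Vec Ω) {φ : Plane → ℝ}
    (hφ : ContDiff ℝ ∞ φ) (hc : HasCompactSupport φ) (k : Fin 2) :
    Integrable (fun x => G x k * φ x) (volume.restrict Ω) :=
  integrable_mul_test
    ((EuclideanSpace.proj k : Plane →L[ℝ] ℝ).comp_memLp' (Lp.memLp G))
    hφ.continuous hc

theorem HasWeakGradient.add {Ω : Set Plane} {f f' : L2 Ω} {G G' : L2Vec Ω}
    (h : HasWeakGradient Ω f G) (h' : HasWeakGradient Ω f' G') :
    HasWeakGradient Ω (f + f') (G + G') := by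
  intro φ hφ hc hs k
  have e1 : ∫ x in Ω, (f + f') x * fderiv ℝ φ x (EuclideanSpace.single k 1)
      = ∫ x in Ω, (f x * fderiv ℝ φ x (EuclideanSpace.single k 1)
          + f' x * fderiv ℝ φ x (EuclideanSpace.single k 1)) := by
    refine integral_congr_ae ?_
    filter_upwards [Lp.coeFn_add f f'] with x hx
    rw [hx, Pi.add_apply, add_mul]
  have e2 : ∫ x in Ω, (G + G') x k * φ x = ∫ x in Ω, (G x k * φ x + G' x k * φ x) := by
    refine integral_congr_ae ?_
    filter_upwards [Lp.coeFn_add G G'] with x hx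
    rw [hx, Pi.add_apply, PiLp.add_apply, add_mul]
  rw [e1, e2, integral_add (integrable_mul_fderiv f hφ hc _) (integrable_mul_fderiv f' hφ hc _),
    integral_add (integrable_coord_mul G hφ hc k) (integrable_coord_mul G' hφ hc k),
    h φ hφ hc hs k, h' φ hφ hc hs k, neg_add]

theorem HasWeakGradient.smul {Ω : Set Plane} (c : ℝ) {f : L2 Ω} {G : L2Vec Ω}
    (h : HasWeakGradient Ω f G) : HasWeakGradient Ω (c • f) (c • G) := by
  intro φ hφ hc hs k
  have e1 : ∫ x in Ω, (c • f) x * fderiv ℝ φ x (EuclideanSpace.single k 1)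
      = ∫ x in Ω, c * (f x * fderiv ℝ φ x (EuclideanSpace.single k 1)) := by
    refine integral_congr_ae ?_
    filter_upwards [Lp.coeFn_smul c f] with x hx
    rw [hx, Pi.smul_apply, smul_eq_mul, mul_assoc]
  have e2 : ∫ x in Ω, (c • G) x k * φ x = ∫ x in Ω, c * (G x k * φ x) := by
    refine integral_congr_ae ?_
    filter_upwards [Lp.coeFn_smul c G] with x hx
    rw [hx, Pi.smul_apply, PiLp.smul_apply, smul_eq_mul, mul_assoc]
  rw [e1, e2, integral_const_mul, integral_const_mul, h φ hφ hc hs k, mul_neg]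

/-- The Sobolev space `H¹(Ω)`, realized as the set of pairs `(f, ∇f)` where `f ∈ L²(Ω)` has the
weak gradient `∇f ∈ L²(Ω; ℝ²)` (which is unique when `Ω` is open), with the norm
`‖f‖₁ = (‖f‖² + ‖∇f‖²)^(1/2)`. -/
def H1 (Ω : Set Plane) : Submodule ℝ (WithLp 2 (L2 Ω × L2Vec Ω)) where
  carrier := {p | HasWeakGradient Ω p.fst p.snd}
  add_mem' h h' := HasWeakGradient.add h h'
  smul_mem' c _ h := HasWeakGradient.smul c h
  zero_mem' := by
    have h : HasWeakGradient Ω ((0 : ℝ) • (0 : L2 Ω)) ((0 : ℝ) • (0 : L2Vec Ω)) := by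
      intro φ hφ hc hs k
      have e1 : ∫ x in Ω, ((0 : ℝ) • (0 : L2 Ω)) x * fderiv ℝ φ x (EuclideanSpace.single k 1)
          = 0 := by
        rw [zero_smul]
        refine integral_eq_zero_of_ae ?_
        filter_upwards [Lp.coeFn_zero ℝ 2 (volume.restrict Ω)] with x hx
        rw [hx]; simp
      have e2 : ∫ x in Ω, ((0 : ℝ) • (0 : L2Vec Ω)) x k * φ x = 0 := by
        rw [zero_smul]
        refine integral_eq_zero_of_ae ?_
        filter_upwards [Lp.coeFn_zero Plane 2 (volume.restrict Ω)] with x hx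
        rw [hx]; simp
      rw [e1, e2, neg_zero]
    simpa using h

/-- `X₀ = L²(Ω) × L²(Ω)`, with its Hilbert norm. -/
abbrev X0 (Ω : Set Plane) : Type := PiLp 2 (fun _ : Fin 2 => L2 Ω)

/-- `X₁ = H¹(Ω) × H¹(Ω)`, with its Hilbert norm. -/
def X1 (Ω : Set Plane) : Type := PiLp 2 (fun _ : Fin 2 => H1 Ω)

instance (Ω : Set Plane) : NormedAddCommGroup (X1 Ω) :=
  inferInstanceAs (NormedAddCommGroup (PiLp 2 (fun _ : Fin 2 => H1 Ω)))

instance (Ω : Set Plane) : InnerProductSpace ℝ (X1 Ω) :=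
  inferInstanceAs (InnerProductSpace ℝ (PiLp 2 (fun _ : Fin 2 => H1 Ω)))

/-- The components of `w = (w₁, w₂) ∈ X₁`. -/
def X1.component {Ω : Set Plane} (w : X1 Ω) (i : Fin 2) : H1 Ω :=
  WithLp.ofLp w i

/-- The inclusion `X₁ ⊆ X₀`. -/
def X1.toX0 {Ω : Set Plane} (w : X1 Ω) : X0 Ω :=
  WithLp.toLp 2 fun i => (w.component i).1.fst

/-- The value `(u(x), v(x))` of `(u, v) ∈ X₀` at the point `x`. -/
def X0.value {Ω : Set Plane} (u : X0 Ω) (x : Plane) : Plane :=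
  WithLp.toLp 2 fun i => u i x

/-- The Jacobian matrix of `w ∈ X₁` at `x`: its row `i` is the gradient of the component `i`. -/
def X1.jacobian {Ω : Set Plane} (w : X1 Ω) (x : Plane) : Matrix (Fin 2) (Fin 2) ℝ :=
  Matrix.of fun i k => (w.component i).1.snd x k

/-- The standing hypotheses on the diffusion matrix `D : ℝ² → M_{2×2}(ℝ)`: uniform positive
definiteness, Lipschitz continuity, and boundedness of the entries. -/
structure IsAdmissible (D : Plane → Matrix (Fin 2) (Fin 2) ℝ) : Prop where
  coercive : ∃ α : ℝ, 0 < α ∧ ∀ z ξ : Plane, α * ‖ξ‖ ^ 2 ≤ ξ.ofLp ⬝ᵥ (D z).mulVec ξ.ofLp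
  lipschitz : ∃ L : ℝ, 0 < L ∧ ∀ z z' : Plane, ∀ i j, |D z' i j - D z i j| ≤ L * ‖z' - z‖
  bounded : ∃ M : ℝ, 0 < M ∧ ∀ z : Plane, ∀ i j, |D z i j| ≤ M

/-- `∫_Ω tr((Jw)ᵀ D(u) (Ju))`. -/
def diffusionForm {Ω : Set Plane} (D : Plane → Matrix (Fin 2) (Fin 2) ℝ) (u w : X1 Ω) : ℝ :=
  ∫ x in Ω, ((w.jacobian x).transpose * D (u.toX0.value x) * u.jacobian x).trace

/-- `g : (0, T) → (X₁)'` is the distributional time derivative of `u : (0, T) → X₀`: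
`∫₀ᵀ φ'(t) ⟨u(t), w⟩ dt = - ∫₀ᵀ φ(t) ⟨g(t), w⟩ dt` for all `φ ∈ C_c^∞(0, T)`, `w ∈ X₁`. -/
def HasTimeDerivative {Ω : Set Plane} (T : ℝ) (u : ℝ → X0 Ω)
    (g : ℝ → StrongDual ℝ (X1 Ω)) : Prop :=
  ∀ φ : ℝ → ℝ, ContDiff ℝ ∞ φ → HasCompactSupport φ → tsupport φ ⊆ Ioo 0 T → ∀ w : X1 Ω,
    ∫ t in Ioc 0 T, deriv φ t * inner ℝ (u t) w.toX0 = - ∫ t in Ioc 0 T, φ t * g t w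

/-- `u` is a weak solution on `Ω × [0, T]`, with initial value `u₀`, of the cross-diffusion system
with diffusion matrix `D` and homogeneous Neumann boundary conditions: `u ∈ C([0, T], X₀)`,
`u ∈ L²(0, T; X₁)` (represented by `U`), `∂ₜu ∈ L²(0, T; (X₁)')` (represented by `g`), and
`⟨∂ₜu, w⟩ + ∫_Ω tr((Jw)ᵀ D(u) (Ju)) = 0` for almost every `t ∈ (0, T]` and all `w ∈ X₁`. -/
def IsWeakSolutionOn (Ω : Set Plane) (D : Plane → Matrix (Fin 2) (Fin 2) ℝ) (T : ℝ)
    (u₀ : X0 Ω) (u : ℝ → X0 Ω) : Prop :=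
  u 0 = u₀ ∧ ContinuousOn u (Icc 0 T) ∧
    ∃ (U : ℝ → X1 Ω) (g : ℝ → StrongDual ℝ (X1 Ω)),
      MemLp U 2 (volume.restrict (Ioc 0 T)) ∧
      (∀ᵐ t ∂volume.restrict (Ioc 0 T), (U t).toX0 = u t) ∧
      MemLp g 2 (volume.restrict (Ioc 0 T)) ∧
      HasTimeDerivative T u g ∧
      ∀ᵐ t ∂volume.restrict (Ioc 0 T), ∀ w : X1 Ω, g t w + diffusionForm D (U t) w = 0

/-- A weak solution for all times `t ≥ 0`. Only the values of `u` on `[0, ∞)` matter. -/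
def IsWeakSolution (Ω : Set Plane) (D : Plane → Matrix (Fin 2) (Fin 2) ℝ)
    (u₀ : X0 Ω) (u : ℝ → X0 Ω) : Prop :=
  ∀ T : ℝ, 0 < T → IsWeakSolutionOn Ω D T u₀ u

/-- There is exactly one weak solution on `[0, ∞)` with initial value `u₀`. -/
def HasUniqueWeakSolution (Ω : Set Plane) (D : Plane → Matrix (Fin 2) (Fin 2) ℝ)
    (u₀ : X0 Ω) : Prop :=
  (∃ u, IsWeakSolution Ω D u₀ u) ∧
    ∀ u u', IsWeakSolution Ω D u₀ u → IsWeakSolution Ω D u₀ u' → ∀ t, 0 ≤ t → u t = u' t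

/-- The scale-space operator `T_t`: the value `T_t(u₀)` is `u(t)` where `u` is the unique weak
solution with initial value `u₀`. It is a partial value, defined exactly when that solution
exists and is unique, so that no default value enters. -/
def scaleSpace (Ω : Set Plane) (D : Plane → Matrix (Fin 2) (Fin 2) ℝ) (t : ℝ)
    (u₀ : X0 Ω) : Part (X0 Ω) :=
  ⟨HasUniqueWeakSolution Ω D u₀, fun h => h.1.choose t⟩

end CrossDiffusion

end

namespace CrossDiffusion

variable {Ω : Set Plane} {D : Plane → Matrix (Fin 2) (Fin 2) ℝ}

/-! The system is odd. Since `D` is even, replacing `u` by `-u` leaves the matrix `D(u)` unchanged,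
so the flux `D(u) Ju` only changes sign (`diffusionForm_neg`). The time derivative is linear in `u`,
so every term of the weak equation changes sign and `-u` solves it with initial value `-u₀`
(`IsWeakSolutionOn.neg`). Negation is an involution, which turns this implication into an
equivalence and carries existence and uniqueness between `u₀` and `-u₀`. Coercivity, bounds and
regularity of `D` play no role. -/

@[simp]
theorem X1.component_neg (w : X1 Ω) (i : Fin 2) : (-w).component i = -w.component i :=
  rfl

@[simp]
theorem X1.toX0_neg (w : X1 Ω) : (-w).toX0 = -w.toX0 :=
  rfl

/-- Only almost everywhere: the representatives of an `L²` class and of its negative are chosen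
independently. The same holds for the Jacobian below. -/
theorem X0.value_neg (u : X0 Ω) :
    ∀ᵐ x ∂volume.restrict Ω, (-u).value x = -u.value x := by
  have h : ∀ᵐ x ∂volume.restrict Ω, ∀ i, (-(u i)) x = -(u i x) :=
    ae_all_iff.2 fun i => Lp.coeFn_neg (u i)
  filter_upwards [h] with x hx
  ext i
  exact hx i

theorem X1.jacobian_neg (w : X1 Ω) :
    ∀ᵐ x ∂volume.restrict Ω, (-w).jacobian x = -w.jacobian x := by
  have h : ∀ᵐ x ∂volume.restrict Ω, ∀ i,
      (-(w.component i).1.snd) x = -((w.component i).1.snd x) :=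
    ae_all_iff.2 fun i => Lp.coeFn_neg (w.component i).1.snd
  filter_upwards [h] with x hx
  ext i k
  exact congrArg (fun z : Plane => z k) (hx i)

/-- Evenness absorbs the sign inside `D`, so exactly one sign survives, that of `Ju`; the test
function `w` is not negated. -/
theorem diffusionForm_neg (hD : ∀ z, D (-z) = D z) (u w : X1 Ω) :
    diffusionForm D (-u) w = -diffusionForm D u w := by
  unfold diffusionForm
  rw [← integral_neg]
  refine integral_congr_ae ?_
  filter_upwards [X0.value_neg u.toX0, X1.jacobian_neg u] with x hv hJ
  rw [X1.toX0_neg, hv, hD, hJ, Matrix.mul_neg, Matrix.trace_neg]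

theorem HasTimeDerivative.neg {T : ℝ} {u : ℝ → X0 Ω} {g : ℝ → StrongDual ℝ (X1 Ω)}
    (h : HasTimeDerivative T u g) : HasTimeDerivative T (-u) (-g) := by
  intro φ hφ hc hs w
  simp only [Pi.neg_apply, inner_neg_left, mul_neg, neg_apply, integral_neg]
  rw [h φ hφ hc hs w]

theorem IsWeakSolutionOn.neg (hD : ∀ z, D (-z) = D z) {T : ℝ} {u₀ : X0 Ω} {u : ℝ → X0 Ω}
    (h : IsWeakSolutionOn Ω D T u₀ u) : IsWeakSolutionOn Ω D T (-u₀) (-u) := by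
  obtain ⟨h0, hcont, U, g, hU, hUu, hg, hder, heq⟩ := h
  refine ⟨congrArg Neg.neg h0, hcont.neg, -U, -g, hU.neg, ?_, hg.neg, hder.neg, ?_⟩
  · filter_upwards [hUu] with t ht
    rw [Pi.neg_apply, Pi.neg_apply, X1.toX0_neg, ht]
  · filter_upwards [heq] with t ht w
    rw [Pi.neg_apply, Pi.neg_apply, neg_apply, diffusionForm_neg hD,
      ← neg_add, ht w, neg_zero]

theorem isWeakSolutionOn_neg_iff (hD : ∀ z, D (-z) = D z) {T : ℝ} {u₀ : X0 Ω}
    {u : ℝ → X0 Ω} :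
    IsWeakSolutionOn Ω D T (-u₀) (-u) ↔ IsWeakSolutionOn Ω D T u₀ u :=
  -- The converse is the forward implication applied to `-u₀` and `-u`.
  ⟨fun h => by simpa only [neg_neg] using h.neg hD, fun h => h.neg hD⟩

theorem IsWeakSolution.neg (hD : ∀ z, D (-z) = D z) {u₀ : X0 Ω} {u : ℝ → X0 Ω}
    (h : IsWeakSolution Ω D u₀ u) : IsWeakSolution Ω D (-u₀) (-u) :=
  fun T hT => (h T hT).neg hD

theorem HasUniqueWeakSolution.neg (hD : ∀ z, D (-z) = D z) {u₀ : X0 Ω}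
    (h : HasUniqueWeakSolution Ω D u₀) : HasUniqueWeakSolution Ω D (-u₀) := by
  obtain ⟨⟨u, hu⟩, huniq⟩ := h
  refine ⟨⟨-u, hu.neg hD⟩, fun v v' hv hv' t ht => ?_⟩
  -- Two solutions from `-u₀` are reflected to solutions from `u₀`, where uniqueness is known.
  have hv₀ : IsWeakSolution Ω D u₀ (-v) := by simpa only [neg_neg] using hv.neg hD
  have hv₀' : IsWeakSolution Ω D u₀ (-v') := by simpa only [neg_neg] using hv'.neg hD
  exact neg_injective (huniq _ _ hv₀ hv₀' t ht)

theorem hasUniqueWeakSolution_neg_iff (hD : ∀ z, D (-z) = D z) {u₀ : X0 Ω} :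
    HasUniqueWeakSolution Ω D (-u₀) ↔ HasUniqueWeakSolution Ω D u₀ :=
  ⟨fun h => by simpa only [neg_neg] using h.neg hD, fun h => h.neg hD⟩

/-- Negating a partial value keeps its domain, so the domains agree by the preceding equivalence. -/
theorem scaleSpace_neg (hD : ∀ z, D (-z) = D z) (u₀ : X0 Ω) {t : ℝ} (ht : 0 ≤ t) :
    scaleSpace Ω D t (-u₀) = -scaleSpace Ω D t u₀ := by
  refine Part.ext' (hasUniqueWeakSolution_neg_iff hD) fun h h' => ?_
  have h₀ : HasUniqueWeakSolution Ω D u₀ := h'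
  -- The solutions chosen for `-u₀` and `u₀` are a priori unrelated; uniqueness at `-u₀` identifies
  -- the former with the negative of the latter, but only at times `t ≥ 0`.
  exact h.2 _ _ h.1.choose_spec (h₀.1.choose_spec.neg hD) t ht

end CrossDiffusion

theorem lemma2
    (Ω : Set CrossDiffusion.Plane)
    (hΩ_open : IsOpen Ω) (hΩ_conn : IsConnected Ω) (hΩ_bdd : Bornology.IsBounded Ω)
    (D : CrossDiffusion.Plane → Matrix (Fin 2) (Fin 2) ℝ)
    (hD : CrossDiffusion.IsAdmissible D)
    (hD_even : ∀ z : CrossDiffusion.Plane, D (-z) = D z) :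
    (∀ (u₀ : CrossDiffusion.X0 Ω) (t : ℝ), 0 ≤ t →
      CrossDiffusion.scaleSpace Ω D t (-u₀) = -CrossDiffusion.scaleSpace Ω D t u₀) ∧
    (∀ (T : ℝ), 0 < T → ∀ (u₀ : CrossDiffusion.X0 Ω) (u : ℝ → CrossDiffusion.X0 Ω),
      CrossDiffusion.IsWeakSolutionOn Ω D T u₀ u ↔
        CrossDiffusion.IsWeakSolutionOn Ω D T (-u₀) (fun t => -u t)) :=
  ⟨fun u₀ _ ht => CrossDiffusion.scaleSpace_neg hD_even u₀ ht,
    fun _ _ _ _ => (CrossDiffusion.isWeakSolutionOn_neg_iff hD_even).symm⟩
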